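/- **Setting.** Let $-\infty\le a<b\le\infty$, let $V\in L^1_{\mathrm{loc}}(a,b)$ be real-valued, let $I\subseteq\mathbb Z$, and let $M=\{x_n\}_{n\in I}\subset(a,b)$ be a set of pairwise distinct points that accumulates at most at $a$ or $b$. For $\Lambda=(\alpha_n)\in\mathbb R^I$, $R=(r_n)\in(0,\infty)^I$ and $\Theta=(\theta_n)\in\mathbb R^I$ put $$A_{\alpha_n,r_n,\theta_n}=\begin{pmatrix}1&\alpha_n\\0&1\end{pmatrix}\begin{pmatrix}r_n&0\\0&1/r_n\end{pmatrix}\begin{pmatrix}\cos\theta_n&-\sin\theta_n\\ \sin\theta_n&\cos\theta_n\end{pmatrix},\qquad \tau f=-f''+Vf .$$ For $z\in\mathbb C$, a solution of $(\tau_{\Lambda,R,\Theta}-z)f=0$ is a function $f$ such that $f,f'$ are locally absolutely continuous in $(a,b)\setminus M$, $-f''+Vf-zf=0$ a.e., and $$\begin{pmatrix}f(x_n+)\\f'(x_n+)\end{pmatrix}=A_{\alpha_n,r_n,\theta_n}\begin{pmatrix}f(x_n-)\\f'(x_n-)\end{pmatrix}\quad\text{for all }n\in I.\qquad(*)$$ We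 say that $\tau_{\Lambda,R,\Theta}$ is in the limit point case at $a$ if for every $z\in\mathbb C$ some solution of $(\tau_{\Lambda,R,\Theta}-z)f=0$ is not square integrable near $a$, and that it is regular at $a$ if $a$ is finite, $V\in L^1_{\mathrm{loc}}[a,b)$ and $a$ is not an accumulation point of $M$; similarly at $b$. Assume that, for all $(\Lambda,R,\Theta)$, $\tau_{\Lambda,R,\Theta}$ is at each of the two endpoints either in the limit point case or regular. Fix $\psi_a,\psi_b\in[0,\pi)$. Let $H_{\Lambda,R,\Theta}$ be the self-adjoint operator $H_{\Lambda,R,\Theta}f=\tau f$ in $L^2(a,b)$ whose domain consists of all $f\in L^2(a,b)$ such that $f,f'$ are locally absolutely continuous in $(a,b)\setminus M$, $\tau f\in L^2(a,b)$, $(*)$ holds, $f(a)\cos\psi_a+f'(a)\sin\psi_a=0$ if $a$ is a regular endpoint, and $f(b)\cos\psi_b+f'(b)\sin\psi_b=0$ if $b$ is a regular endpoint. Let $\sigma_p$ denote the set of eigenvalues. **Theorem.** Let $(p_n)_{n\in I}$ and $(q_n)_{n\in I}$ be families of Borel probability measures on $\mathbb R$ and $(\rho_n)_{n\in I}$ a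 family of Borel probability measures on $(0,\infty)$. Let $\mathbb P_1=\times_{n\in I}p_n$ on $\mathbb R^I$, $\mathbb P_2=\times_{n\in I}\rho_n$ on $(0,\infty)^I$, $\mathbb P_3=\times_{n\in I}q_n$ on $\mathbb R^I$ be the product measures, and $\mathbb P=\mathbb P_1\times\mathbb P_2\times\mathbb P_3$. Assume that for some $n_0\in I$ the measure $q_{n_0}$ is continuous, that is, $q_{n_0}(\{t\})=0$ for all $t\in\mathbb R$. Let $E\in\mathbb R$ be fixed, and suppose that $$P(E)=\{(\Lambda,R,\Theta)\in\mathbb R^I\times(0,\infty)^I\times\mathbb R^I:\ E\in\sigma_p(H_{\Lambda,R,\Theta})\}$$ is measurable with respect to the product $\sigma$-algebra or, more generally, its completion under $\mathbb P$. Then $$\mathbb P(P(E))=0 .$$ -/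

import Mathlib

open MeasureTheory Set Filter Topology

namespace PointInteraction

noncomputable section

/-- The real points of the open interval `(a, b)`, where `-∞ ≤ a < b ≤ ∞`. -/
def openInterval (a b : EReal) : Set ℝ := {t : ℝ | a < (t : EReal) ∧ (t : EReal) < b}

/-- The real `2 × 2` matrix `A_{α,r,θ} = P_α H_r E_θ` (Iwasawa decomposition):
a parabolic, a hyperbolic and an elliptic factor. -/
def interactionMatrix (α r θ : ℝ) : Matrix (Fin 2) (Fin 2) ℝ :=
  !![1, α; 0, 1] * !![r, 0; 0, 1 / r] * !![Real.cos θ, -Real.sin θ; Real.sin θ, Real.cos θ]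

/-- `f` is absolutely continuous on every compact interval contained in `U`. -/
def LocallyAC (f : ℝ → ℂ) (U : Set ℝ) : Prop :=
  ∀ c d : ℝ, c ≤ d → Icc c d ⊆ U → AbsolutelyContinuousOnInterval f c d

/-- `f` and `f'` are (locally) absolutely continuous on the open set `U`. -/
def HasACDerivative (f : ℝ → ℂ) (U : Set ℝ) : Prop :=
  LocallyAC f U ∧ DifferentiableOn ℝ f U ∧ LocallyAC (deriv f) U

/-- The differential expression `τ f = -f'' + V f`. -/
def tau (V : ℝ → ℝ) (f : ℝ → ℂ) : ℝ → ℂ :=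
  fun t => -deriv (deriv f) t + (V t : ℂ) * f t

/-- `(f, f')` has the limit `(p, p')` along the filter `l`. -/
def HasLimitData (f : ℝ → ℂ) (l : Filter ℝ) (p p' : ℂ) : Prop :=
  Tendsto f l (𝓝 p) ∧ Tendsto (deriv f) l (𝓝 p')

/-- The interaction condition at the point `y` with matrix `A`: the one-sided limits exist and
`(f(y+), f'(y+))ᵀ = A (f(y-), f'(y-))ᵀ`. -/
def JumpCondition (A : Matrix (Fin 2) (Fin 2) ℝ) (y : ℝ) (f : ℝ → ℂ) : Prop :=
  ∃ p p' q q' : ℂ, HasLimitData f (𝓝[<] y) p p' ∧ HasLimitData f (𝓝[>] y) q q' ∧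
    ![q, q'] = (A.map Complex.ofReal).mulVec ![p, p']

section Operator

variable {I : Set ℤ} (a b : EReal) (V : ℝ → ℝ) (x : I → ℝ)
  (Λ : I → ℝ) (R : I → Ioi (0 : ℝ)) (Θ : I → ℝ)

/-- `f` satisfies the interaction condition with matrix `A_{α_n,r_n,θ_n}` at `x_n`, for all `n`. -/
def JumpConditions (f : ℝ → ℂ) : Prop :=
  ∀ n : I, JumpCondition (interactionMatrix (Λ n) (R n) (Θ n)) (x n) f

/-- `f` is a solution of `(τ_{Λ,R,Θ} - z) f = 0` on `(a, b)`. -/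
def IsSolution (z : ℂ) (f : ℝ → ℂ) : Prop :=
  HasACDerivative f (openInterval a b \ range x) ∧
  (∀ᵐ t ∂volume.restrict (openInterval a b), tau V f t - z * f t = 0) ∧
  JumpConditions x Λ R Θ f

/-- `f` is square integrable near the left endpoint `a`. -/
def LiesLeft (f : ℝ → ℂ) : Prop :=
  ∃ c ∈ openInterval a b, MemLp f 2 (volume.restrict (openInterval a c))

/-- `f` is square integrable near the right endpoint `b`. -/
def LiesRight (f : ℝ → ℂ) : Prop :=
  ∃ c ∈ openInterval a b, MemLp f 2 (volume.restrict (openInterval c b))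

/-- `τ_{Λ,R,Θ}` is in the limit point case at `a`. -/
def LimitPointLeft : Prop :=
  ∀ z : ℂ, ∃ f : ℝ → ℂ, IsSolution a b V x Λ R Θ z f ∧ ¬ LiesLeft a b f

/-- `τ_{Λ,R,Θ}` is in the limit point case at `b`. -/
def LimitPointRight : Prop :=
  ∀ z : ℂ, ∃ f : ℝ → ℂ, IsSolution a b V x Λ R Θ z f ∧ ¬ LiesRight a b f

/-- `τ_{Λ,R,Θ}` is regular at `a`, the real number `a₀` being the value of `a`: `V` is locally
integrable on `[a, b)`, and the points `x_n` do not accumulate at `a`.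
This does not depend on `Λ`, `R`, `Θ`. -/
def RegularLeft (a₀ : ℝ) : Prop :=
  a = (a₀ : EReal) ∧
  LocallyIntegrableOn V {t : ℝ | a ≤ (t : EReal) ∧ (t : EReal) < b} ∧
  ∃ c : ℝ, a₀ < c ∧ ∀ n : I, c ≤ x n

/-- `τ_{Λ,R,Θ}` is regular at `b`, the real number `b₀` being the value of `b`. -/
def RegularRight (b₀ : ℝ) : Prop :=
  b = (b₀ : EReal) ∧
  LocallyIntegrableOn V {t : ℝ | a < (t : EReal) ∧ (t : EReal) ≤ b} ∧
  ∃ c : ℝ, c < b₀ ∧ ∀ n : I, x n ≤ c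

/-- The domain of the maximal operator `T_{Λ,R,Θ}` in `L²(a, b)`. -/
def MemMaximalDomain (f : ℝ → ℂ) : Prop :=
  MemLp f 2 (volume.restrict (openInterval a b)) ∧
  HasACDerivative f (openInterval a b \ range x) ∧
  MemLp (tau V f) 2 (volume.restrict (openInterval a b)) ∧
  JumpConditions x Λ R Θ f

/-- The separated boundary condition `f cos ψ + f' sin ψ = 0`, for the limits of `f` and `f'`
along `l`. -/
def BoundaryCondition (ψ : ℝ) (l : Filter ℝ) (f : ℝ → ℂ) : Prop :=
  ∃ p p' : ℂ, HasLimitData f l p p' ∧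
    p * (Real.cos ψ : ℂ) + p' * (Real.sin ψ : ℂ) = 0

variable (ψa ψb : ℝ)

/-- The domain of the operator `H_{Λ,R,Θ}`, which acts as `τ`: the functions in the domain of
`T_{Λ,R,Θ}` that satisfy the separated boundary condition with angle `ψa` (`ψb`) at `a` (`b`) if
`τ_{Λ,R,Θ}` is regular there. No condition is imposed at an endpoint in the limit point case.
This is the self-adjoint operator whenever each endpoint is regular or in the limit
point case. -/
def MemDomain (f : ℝ → ℂ) : Prop :=
  MemMaximalDomain a b V x Λ R Θ f ∧
  (∀ a₀ : ℝ, RegularLeft a b V x a₀ → BoundaryCondition ψa (𝓝[>] a₀) f) ∧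
  (∀ b₀ : ℝ, RegularRight a b V x b₀ → BoundaryCondition ψb (𝓝[<] b₀) f)

/-- `E ∈ σ_p(H_{Λ,R,Θ})`: there is `f` in the domain of `H_{Λ,R,Θ}`, nonzero as an element of
`L²(a, b)`, with `H_{Λ,R,Θ} f = E f` in `L²(a, b)`. -/
def IsEigenvalue (E : ℝ) : Prop :=
  ∃ f : ℝ → ℂ, MemDomain a b V x Λ R Θ ψa ψb f ∧
    ¬ (f =ᵐ[volume.restrict (openInterval a b)] 0) ∧
    tau V f =ᵐ[volume.restrict (openInterval a b)] fun t => (E : ℂ) * f t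

/-- The set `P(E)` of all parameters `(Λ, R, Θ)` with `E ∈ σ_p(H_{Λ,R,Θ})`. -/
def eigenvalueSet (E : ℝ) : Set ((I → ℝ) × (I → Ioi (0 : ℝ)) × (I → ℝ)) :=
  {ω | IsEigenvalue a b V x ω.1 ω.2.1 ω.2.2 ψa ψb E}

end Operator

/-- The law `ℙ = ℙ₁ × ℙ₂ × ℙ₃` of the random parameters `(Λ, R, Θ)`, where
`ℙ₁ = ×ₙ pₙ`, `ℙ₂ = ×ₙ ρₙ` and `ℙ₃ = ×ₙ qₙ` are product measures. -/
def parameterLaw {I : Set ℤ} (p : I → Measure ℝ) (ρ : I → Measure (Ioi (0 : ℝ)))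
    (q : I → Measure ℝ) : Measure ((I → ℝ) × (I → Ioi (0 : ℝ)) × (I → ℝ)) :=
  (Measure.infinitePi p).prod ((Measure.infinitePi ρ).prod (Measure.infinitePi q))

end

end PointInteraction

/-!
Fix all parameters except the angle `θ` at `x_{n₀}`. If `E` is an eigenvalue for both `θ` and `θ'`,
with eigenfunctions `f` and `g`, then the Wronskian of `f` with either of `g` and `conj g` is
constant on each side of `x_{n₀}`, since the interaction matrices are real and unimodular. It
vanishes there: at a regular endpoint because both functions satisfy the same boundary condition,
and at a limit point endpoint because otherwise every solution would be a combination of two square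
integrable ones. So the left Cauchy data `u` of `f` and `v` of `g` at `x_{n₀}` satisfy
`u ∧ v = u ∧ v̄ = 0`, while on the right `0 = (A_θ u) ∧ (A_θ' v̄) = sin (θ' - θ) (u · v̄)`. Here
`u · v̄ ≠ 0`, because `u` and `v` are parallel and, by unique continuation, nonzero. Hence
`θ' - θ ∈ π ℤ`, so only countably many angles produce the eigenvalue `E`, and these form a null set
for a continuous `q_{n₀}`. Since resampling the coordinate `n₀` independently does not change the
product measure, Fubini's theorem concludes.
-/

namespace PointInteraction

/-! ### Absolute continuity and Gronwall's inequality -/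

theorem absolutelyContinuousOnInterval_lipschitzOnWith_comp {X Y : Type*} [PseudoMetricSpace X]
    [PseudoMetricSpace Y] {φ : X → Y} {f : ℝ → X} {c d : ℝ} {K : NNReal} {s : Set X}
    (hφ : LipschitzOnWith K φ s) (hf : AbsolutelyContinuousOnInterval f c d)
    (hs : MapsTo f (uIcc c d) s) : AbsolutelyContinuousOnInterval (φ ∘ f) c d := by
  refine squeeze_zero' (g := fun E : ℕ × (ℕ → ℝ × ℝ) =>
      (K : ℝ) * ∑ i ∈ Finset.range E.1, dist (f (E.2 i).1) (f (E.2 i).2)) ?_ ?_ ?_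
  · exact Eventually.of_forall fun _ => Finset.sum_nonneg fun _ _ => dist_nonneg
  · rw [eventually_inf_principal]
    refine Eventually.of_forall fun D hD => ?_
    rw [Finset.mul_sum]
    exact Finset.sum_le_sum fun i hi =>
      hφ.dist_le_mul _ (hs (hD.1 i hi).1) _ (hs (hD.1 i hi).2)
  · simpa only [mul_zero] using Tendsto.const_mul (K : ℝ) hf

theorem absolutelyContinuousOnInterval_lipschitzWith_comp {X Y : Type*} [PseudoMetricSpace X]
    [PseudoMetricSpace Y] {φ : X → Y} {f : ℝ → X} {c d : ℝ} {K : NNReal}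
    (hφ : LipschitzWith K φ) (hf : AbsolutelyContinuousOnInterval f c d) :
    AbsolutelyContinuousOnInterval (φ ∘ f) c d :=
  absolutelyContinuousOnInterval_lipschitzOnWith_comp (hφ.lipschitzOnWith (s := univ)) hf
    (mapsTo_univ _ _)

theorem absolutelyContinuousOnInterval_exp {f : ℝ → ℝ} {c d : ℝ}
    (hf : AbsolutelyContinuousOnInterval f c d) :
    AbsolutelyContinuousOnInterval (Real.exp ∘ f) c d := by
  obtain ⟨C, hC⟩ := hf.exists_bound
  obtain ⟨K, hK⟩ := (Real.contDiff_exp.contDiffOn (s := Icc (-C) C) (n := 1)).exists_lipschitzOnWith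
    one_ne_zero (convex_Icc _ _) isCompact_Icc
  exact absolutelyContinuousOnInterval_lipschitzOnWith_comp hK hf fun t ht => abs_le.1 (hC t ht)

theorem absolutelyContinuousOnInterval_pi {ι : Type*} [Fintype ι] {X : ι → Type*}
    [∀ i, PseudoMetricSpace (X i)] {f : ℝ → ∀ i, X i} {c d : ℝ}
    (hf : ∀ i, AbsolutelyContinuousOnInterval (fun t => f t i) c d) :
    AbsolutelyContinuousOnInterval f c d := by
  refine squeeze_zero (g := fun E : ℕ × (ℕ → ℝ × ℝ) =>
      ∑ i, ∑ k ∈ Finset.range E.1, dist (f (E.2 k).1 i) (f (E.2 k).2 i)) ?_ ?_ ?_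
  · exact fun _ => Finset.sum_nonneg fun _ _ => dist_nonneg
  · intro D
    rw [Finset.sum_comm]
    refine Finset.sum_le_sum fun k _ => (dist_pi_le_iff ?_).2 fun i => ?_
    · exact Finset.sum_nonneg fun _ _ => dist_nonneg
    · exact Finset.single_le_sum (f := fun i => dist (f (D.2 k).1 i) (f (D.2 k).2 i))
        (fun _ _ => dist_nonneg) (Finset.mem_univ i)
  · simpa only [Finset.sum_const_zero] using tendsto_finsetSum Finset.univ fun i _ => hf i

theorem le_of_ae_deriv_nonneg {f : ℝ → ℝ} {c d : ℝ} (hcd : c ≤ d)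
    (hf : AbsolutelyContinuousOnInterval f c d)
    (hf' : ∀ᵐ t, t ∈ uIcc c d → 0 ≤ deriv f t) : f c ≤ f d := by
  rw [uIcc_of_le hcd] at hf'
  rw [← sub_nonneg, ← hf.integral_deriv_eq_sub]
  exact intervalIntegral.integral_nonneg_of_ae_restrict hcd
    ((ae_restrict_iff' measurableSet_Icc).2 hf')

theorem mul_exp_le_mul_exp {N K : ℝ → ℝ} {c d : ℝ} (hcd : c ≤ d)
    (hN : AbsolutelyContinuousOnInterval N c d) (hK : AbsolutelyContinuousOnInterval K c d)
    (h : ∀ᵐ t, t ∈ uIcc c d → 0 ≤ deriv N t + N t * deriv K t) :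
    N c * Real.exp (K c) ≤ N d * Real.exp (K d) := by
  refine le_of_ae_deriv_nonneg hcd (hN.fun_mul (absolutelyContinuousOnInterval_exp hK)) ?_
  filter_upwards [hN.ae_differentiableAt, hK.ae_differentiableAt, h] with t hNt hKt ht hmem
  have hderiv : HasDerivAt (fun t => N t * Real.exp (K t))
      ((deriv N t + N t * deriv K t) * Real.exp (K t)) t :=
    ((hNt hmem).hasDerivAt.mul (hKt hmem).hasDerivAt.exp).congr_deriv (by ring)
  exact hderiv.deriv ▸ mul_nonneg (ht hmem) (Real.exp_nonneg _)

theorem abs_deriv_norm_le {F : Type*} [NormedAddCommGroup F] [NormedSpace ℝ F] {Y : ℝ → F}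
    {Y' : F} {t : ℝ} (hY : HasDerivAt Y Y' t) : |deriv (fun s => ‖Y s‖) t| ≤ ‖Y'‖ := by
  by_cases hN : DifferentiableAt ℝ (fun s => ‖Y s‖) t
  · refine le_of_tendsto_of_tendsto (hasDerivAt_iff_tendsto_slope.1 hN.hasDerivAt).abs
      (hasDerivAt_iff_tendsto_slope.1 hY).norm (Eventually.of_forall fun s => ?_)
    simp only [slope_def_module, norm_smul, smul_eq_mul, abs_mul, Real.norm_eq_abs]
    exact mul_le_mul_of_nonneg_left (abs_norm_sub_norm_le _ _) (abs_nonneg _)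
  · rw [deriv_zero_of_not_differentiableAt hN, abs_zero]
    exact norm_nonneg Y'

theorem norm_le_exp_integral_mul_norm {F : Type*} [NormedAddCommGroup F] [NormedSpace ℝ F]
    {Y Y' : ℝ → F} {k : ℝ → ℝ} {c d : ℝ} (hcd : c ≤ d)
    (hY : AbsolutelyContinuousOnInterval Y c d)
    (hY' : ∀ᵐ t, t ∈ uIcc c d → HasDerivAt Y (Y' t) t ∧ ‖Y' t‖ ≤ k t * ‖Y t‖)
    (hk : IntervalIntegrable k volume c d) :
    ‖Y d‖ ≤ Real.exp (∫ t in c..d, k t) * ‖Y c‖ ∧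
      ‖Y c‖ ≤ Real.exp (∫ t in c..d, k t) * ‖Y d‖ := by
  set K : ℝ → ℝ := fun t => ∫ u in c..t, k u
  have hN : AbsolutelyContinuousOnInterval (fun t => ‖Y t‖) c d :=
    absolutelyContinuousOnInterval_lipschitzWith_comp lipschitzWith_one_norm hY
  have hK : AbsolutelyContinuousOnInterval K c d :=
    hk.absolutelyContinuousOnInterval_intervalIntegral left_mem_uIcc
  have hKc : K c = 0 := intervalIntegral.integral_same
  have hderiv : ∀ᵐ t, t ∈ uIcc c d →
      deriv K t = k t ∧ |deriv (fun s => ‖Y s‖) t| ≤ k t * ‖Y t‖ := by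
    filter_upwards [hk.ae_hasDerivAt_integral, hY'] with t hKt ht hmem
    exact ⟨(hKt hmem c left_mem_uIcc).deriv, (abs_deriv_norm_le (ht hmem).1).trans (ht hmem).2⟩
  constructor
  · have hle : -‖Y c‖ * Real.exp (-K c) ≤ -‖Y d‖ * Real.exp (-K d) := by
      refine mul_exp_le_mul_exp hcd hN.fun_neg hK.fun_neg ?_
      filter_upwards [hderiv] with t ht hmem
      obtain ⟨hKt, hNt⟩ := ht hmem
      rw [deriv.fun_neg, deriv.fun_neg, hKt]
      linarith [(abs_le.1 hNt).2]
    rw [hKc, neg_zero, Real.exp_zero, Real.exp_neg, mul_one, neg_mul, neg_le_neg_iff,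
      ← div_eq_mul_inv, div_le_iff₀' (Real.exp_pos _)] at hle
    exact hle
  · have hle : ‖Y c‖ * Real.exp (K c) ≤ ‖Y d‖ * Real.exp (K d) := by
      refine mul_exp_le_mul_exp hcd hN hK ?_
      filter_upwards [hderiv] with t ht hmem
      obtain ⟨hKt, hNt⟩ := ht hmem
      rw [hKt]
      linarith [(abs_le.1 hNt).1]
    rwa [hKc, Real.exp_zero, mul_one, mul_comm] at hle

/-! ### Vectors in the plane -/

section Wronskian

variable {K : Type*} [CommRing K]

/-- The Wronskian form `u₀ v₁ - u₁ v₀`; on Cauchy data of `f` and `g` it is `f g' - f' g`. -/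
def wronskian (u v : Fin 2 → K) : K := u 0 * v 1 - u 1 * v 0

theorem wronskian_mulVec (A : Matrix (Fin 2) (Fin 2) K) (u v : Fin 2 → K) :
    wronskian (A.mulVec u) (A.mulVec v) = A.det * wronskian u v := by
  simp only [wronskian, Matrix.mulVec, dotProduct, Fin.sum_univ_two, Matrix.det_fin_two]
  ring

theorem wronskian_smul_eq_add (u v w : Fin 2 → K) :
    wronskian u v • w = wronskian w v • u + wronskian u w • v := by
  refine funext (Fin.forall_fin_two.2 ⟨?_, ?_⟩) <;>
  · simp only [wronskian, Pi.add_apply, Pi.smul_apply, smul_eq_mul]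
    ring

theorem wronskian_eq_zero_of_dotProduct_eq_zero [IsDomain K] {w u v : Fin 2 → K} (hw : w ≠ 0)
    (hu : w ⬝ᵥ u = 0) (hv : w ⬝ᵥ v = 0) : wronskian u v = 0 := by
  rw [dotProduct, Fin.sum_univ_two] at hu hv
  by_contra hne
  have hmul : ∀ i, w i * wronskian u v = 0 := by
    simp only [wronskian, Fin.forall_fin_two]
    constructor
    · linear_combination v 1 * hu - u 1 * hv
    · linear_combination u 0 * hv - v 0 * hu
  exact hw (funext fun i => (mul_eq_zero.1 (hmul i)).resolve_right hne)

theorem continuous_wronskian [TopologicalSpace K] [IsTopologicalRing K] :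
    Continuous fun z : (Fin 2 → K) × (Fin 2 → K) => wronskian z.1 z.2 := by
  unfold wronskian
  fun_prop

theorem tendsto_wronskian [TopologicalSpace K] [IsTopologicalRing K] {X : Type*}
    {F : Filter X} {Y Z : X → Fin 2 → K} {u v : Fin 2 → K} (hY : Tendsto Y F (𝓝 u))
    (hZ : Tendsto Z F (𝓝 v)) : Tendsto (fun t => wronskian (Y t) (Z t)) F (𝓝 (wronskian u v)) :=
  (continuous_wronskian.tendsto (u, v)).comp (hY.prodMk_nhds hZ)

theorem dotProduct_star_ne_zero_of_wronskian_eq_zero [StarRing K] [PartialOrder K]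
    [StarOrderedRing K] [NoZeroDivisors K] {u v : Fin 2 → K} (hu : u ≠ 0) (hv : v ≠ 0)
    (h : wronskian u v = 0) :
    u ⬝ᵥ star v ≠ 0 := by
  have huv : ∀ i, u i * (v ⬝ᵥ star v) = v i * (u ⬝ᵥ star v) := by
    rw [wronskian] at h
    simp only [dotProduct, Fin.sum_univ_two, Fin.forall_fin_two]
    constructor
    · linear_combination star v 1 * h
    · linear_combination -star v 0 * h
  intro h0
  have hmul : ∀ i, u i * (v ⬝ᵥ star v) = 0 := fun i => by rw [huv i, h0, mul_zero]
  exact hu (funext fun i =>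
    (mul_eq_zero.1 (hmul i)).resolve_right (mt dotProduct_self_star_eq_zero.1 hv))

end Wronskian

theorem mulVec_map_ofReal_eq_zero_iff {n : Type*} [Fintype n] [DecidableEq n] {A : Matrix n n ℝ}
    (hA : A.det ≠ 0) {u : n → ℂ} : (A.map Complex.ofReal).mulVec u = 0 ↔ u = 0 := by
  refine ⟨Matrix.eq_zero_of_mulVec_eq_zero ?_, fun h => by rw [h, Matrix.mulVec_zero]⟩
  exact (Complex.ofRealHom.map_det A).symm.trans_ne (Complex.ofReal_ne_zero.2 hA)

theorem star_map_ofReal_mulVec {m n : Type*} [Fintype n] (A : Matrix m n ℝ) (u : n → ℂ) :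
    star ((A.map Complex.ofReal).mulVec u) = (A.map Complex.ofReal).mulVec (star u) := by
  ext i
  simp [Matrix.mulVec, dotProduct]

theorem wronskian_map_ofReal_mulVec (A : Matrix (Fin 2) (Fin 2) ℝ) (u v : Fin 2 → ℂ) :
    wronskian ((A.map Complex.ofReal).mulVec u) ((A.map Complex.ofReal).mulVec v) =
      A.det * wronskian u v := by
  rw [wronskian_mulVec]
  exact congrArg (· * _) (Complex.ofRealHom.map_det A).symm

theorem det_interactionMatrix (α θ : ℝ) {r : ℝ} (hr : r ≠ 0) :
    (interactionMatrix α r θ).det = 1 := by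
  simp only [interactionMatrix, Matrix.det_mul, Matrix.det_fin_two_of]
  field_simp
  linear_combination Real.cos_sq_add_sin_sq θ

/-- Only the angle between the two rotations is visible to the Wronskian, the other two factors
being common to both matrices and unimodular. -/
theorem wronskian_interactionMatrix_mulVec (α θ θ' : ℝ) {r : ℝ} (hr : r ≠ 0) (u v : Fin 2 → ℂ) :
    wronskian (((interactionMatrix α r θ).map Complex.ofReal).mulVec u)
        (((interactionMatrix α r θ').map Complex.ofReal).mulVec v) =
      Real.cos (θ' - θ) * wronskian u v + Real.sin (θ' - θ) * (u ⬝ᵥ v) := by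
  set P : Matrix (Fin 2) (Fin 2) ℝ := !![1, α; 0, 1] * !![r, 0; 0, 1 / r]
  have hP : P.det = 1 := by simp [P, hr]
  have hmap (θ : ℝ) (w : Fin 2 → ℂ) : ((interactionMatrix α r θ).map Complex.ofReal).mulVec w =
      (P.map Complex.ofReal).mulVec
        ((!![Real.cos θ, -Real.sin θ; Real.sin θ, Real.cos θ].map Complex.ofReal).mulVec w) := by
    rw [Matrix.mulVec_mulVec]
    exact congrArg (Matrix.mulVec · w) (Matrix.map_mul (f := Complex.ofRealHom))
  rw [hmap, hmap, wronskian_map_ofReal_mulVec, hP, Real.cos_sub, Real.sin_sub]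
  simp only [wronskian, Matrix.mulVec, dotProduct, Fin.sum_univ_two, Matrix.map_apply,
    Matrix.of_apply, Matrix.cons_val', Matrix.cons_val_zero, Matrix.cons_val_one,
    Matrix.cons_val_fin_one]
  push_cast
  ring

open scoped ComplexOrder in
theorem sin_sub_eq_zero_of_wronskian_eq_zero {α r θ θ' : ℝ} (hr : r ≠ 0) {u v : Fin 2 → ℂ}
    (hu : u ≠ 0) (hv : v ≠ 0) (huv : wronskian u v = 0) (huv' : wronskian u (star v) = 0)
    (hA : wronskian (((interactionMatrix α r θ).map Complex.ofReal).mulVec u)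
      (((interactionMatrix α r θ').map Complex.ofReal).mulVec (star v)) = 0) :
    Real.sin (θ' - θ) = 0 := by
  rw [wronskian_interactionMatrix_mulVec α θ θ' hr, huv', mul_zero, zero_add] at hA
  exact Complex.ofReal_eq_zero.1 ((mul_eq_zero.1 hA).resolve_right
    (dotProduct_star_ne_zero_of_wronskian_eq_zero hu hv huv))

theorem countable_of_forall_sin_sub_eq_zero {S : Set ℝ}
    (hS : ∀ s ∈ S, ∀ t ∈ S, Real.sin (t - s) = 0) : S.Countable := by
  rcases S.eq_empty_or_nonempty with rfl | ⟨s, hs⟩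
  · exact countable_empty
  · refine (countable_range fun k : ℤ => s + k * Real.pi).mono fun t ht => ?_
    obtain ⟨k, hk⟩ := Real.sin_eq_zero_iff.1 (hS s hs t ht)
    exact ⟨k, by linear_combination hk⟩

/-! ### Cauchy data -/

section CauchyData

/-- The Cauchy data `(f, f')` of `f` at `t`. -/
noncomputable def cauchyData (f : ℝ → ℂ) (t : ℝ) : Fin 2 → ℂ := ![f t, deriv f t]

variable {f : ℝ → ℂ} {U : Set ℝ} {l : Filter ℝ}

theorem hasLimitData_iff {u : Fin 2 → ℂ} :
    HasLimitData f l (u 0) (u 1) ↔ Tendsto (cauchyData f) l (𝓝 u) := by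
  simp only [HasLimitData, tendsto_pi_nhds, Fin.forall_fin_two]
  rfl

theorem jumpCondition_iff {A : Matrix (Fin 2) (Fin 2) ℝ} {y : ℝ} :
    JumpCondition A y f ↔ ∃ u : Fin 2 → ℂ, Tendsto (cauchyData f) (𝓝[<] y) (𝓝 u) ∧
      Tendsto (cauchyData f) (𝓝[>] y) (𝓝 ((A.map Complex.ofReal).mulVec u)) := by
  constructor
  · rintro ⟨p, p', q, q', hp, hq, hA⟩
    exact ⟨![p, p'], hasLimitData_iff.1 hp, hA ▸ hasLimitData_iff.1 hq⟩
  · rintro ⟨u, hu, hAu⟩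
    have heta (v : Fin 2 → ℂ) : ![v 0, v 1] = v := funext (Fin.forall_fin_two.2 ⟨rfl, rfl⟩)
    exact ⟨_, _, _, _, hasLimitData_iff.2 hu, hasLimitData_iff.2 hAu,
      by rw [heta, heta]⟩

theorem boundaryCondition_iff {ψ : ℝ} :
    BoundaryCondition ψ l f ↔ ∃ u : Fin 2 → ℂ, Tendsto (cauchyData f) l (𝓝 u) ∧
      ![(Real.cos ψ : ℂ), (Real.sin ψ : ℂ)] ⬝ᵥ u = 0 := by
  have hdot (u : Fin 2 → ℂ) : ![(Real.cos ψ : ℂ), (Real.sin ψ : ℂ)] ⬝ᵥ u =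
      u 0 * (Real.cos ψ : ℂ) + u 1 * (Real.sin ψ : ℂ) := by
    rw [dotProduct, Fin.sum_univ_two, mul_comm (u 0), mul_comm (u 1)]
    rfl
  constructor
  · rintro ⟨p, p', hp, h0⟩
    exact ⟨![p, p'], hasLimitData_iff.1 hp, (hdot _).trans h0⟩
  · rintro ⟨u, hu, h0⟩
    exact ⟨u 0, u 1, hasLimitData_iff.2 hu, (hdot u).symm.trans h0⟩

theorem deriv_star (f : ℝ → ℂ) : deriv (star f) = star (deriv f) :=
  deriv.star'

theorem cauchyData_star (f : ℝ → ℂ) : cauchyData (star f) = star (cauchyData f) := by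
  ext t i
  fin_cases i
  · rfl
  · exact congrFun (deriv_star f) t

theorem tendsto_cauchyData_star {u : Fin 2 → ℂ} (h : Tendsto (cauchyData f) l (𝓝 u)) :
    Tendsto (cauchyData (star f)) l (𝓝 (star u)) := by
  rw [cauchyData_star]
  exact h.star

theorem JumpCondition.star {A : Matrix (Fin 2) (Fin 2) ℝ} {y : ℝ} (hf : JumpCondition A y f) :
    JumpCondition A y (star f) := by
  obtain ⟨u, hu, hAu⟩ := jumpCondition_iff.1 hf
  refine jumpCondition_iff.2 ⟨_, tendsto_cauchyData_star hu, ?_⟩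
  rw [← star_map_ofReal_mulVec]
  exact tendsto_cauchyData_star hAu

theorem BoundaryCondition.star {ψ : ℝ} (h : BoundaryCondition ψ l f) :
    BoundaryCondition ψ l (star f) := by
  obtain ⟨u, hu, h0⟩ := boundaryCondition_iff.1 h
  refine boundaryCondition_iff.2 ⟨_, tendsto_cauchyData_star hu, ?_⟩
  simpa [-Complex.ofReal_cos, -Complex.ofReal_sin, dotProduct] using congrArg (starRingEnd ℂ) h0

theorem LocallyAC.mono {W : Set ℝ} (hf : LocallyAC f U) (h : W ⊆ U) : LocallyAC f W :=
  fun c d hcd hs => hf c d hcd (hs.trans h)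

theorem LocallyAC.star (hf : LocallyAC f U) : LocallyAC (star f) U := fun c d hcd hs =>
  absolutelyContinuousOnInterval_lipschitzWith_comp (φ := Star.star)
    (starₗᵢ ℂ (E := ℂ)).lipschitz (hf c d hcd hs)

theorem HasACDerivative.mono {W : Set ℝ} (hf : HasACDerivative f U) (h : W ⊆ U) :
    HasACDerivative f W :=
  ⟨hf.1.mono h, hf.2.1.mono h, hf.2.2.mono h⟩

theorem HasACDerivative.star (hf : HasACDerivative f U) : HasACDerivative (star f) U :=
  ⟨hf.1.star, hf.2.1.star, deriv_star f ▸ hf.2.2.star⟩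

theorem HasACDerivative.absolutelyContinuousOnInterval_cauchyData (hf : HasACDerivative f U)
    {c d : ℝ} (hcd : c ≤ d) (hs : Icc c d ⊆ U) :
    AbsolutelyContinuousOnInterval (cauchyData f) c d :=
  absolutelyContinuousOnInterval_pi
    (Fin.forall_fin_two.2 ⟨hf.1 c d hcd hs, hf.2.2 c d hcd hs⟩)

end CauchyData

/-! ### Solutions on open sets without interaction points -/

section SolvesOn

/-- `f` solves `τ f = z f` on `U`, there being no interactions in `U`. -/
def SolvesOn (V : ℝ → ℝ) (z : ℂ) (U : Set ℝ) (f : ℝ → ℂ) : Prop :=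
  HasACDerivative f U ∧ ∀ᵐ t ∂volume.restrict U, tau V f t = z * f t

variable {V : ℝ → ℝ} {z : ℂ} {U : Set ℝ} {f g : ℝ → ℂ} {l r : ℝ}

theorem SolvesOn.mono (hf : SolvesOn V z U f) {W : Set ℝ} (h : W ⊆ U) : SolvesOn V z W f :=
  ⟨hf.1.mono h, ae_restrict_of_ae_restrict_of_subset h hf.2⟩

theorem tau_star (V : ℝ → ℝ) (f : ℝ → ℂ) (t : ℝ) : tau V (star f) t = star (tau V f t) := by
  simp only [tau, deriv_star, Pi.star_apply, star_add, star_neg, star_mul', Complex.star_def,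
    Complex.conj_ofReal]

theorem SolvesOn.ae_hasDerivAt_cauchyData (hU : IsOpen U) (hf : SolvesOn V z U f) {c d : ℝ}
    (hcd : c ≤ d) (hs : Icc c d ⊆ U) :
    ∀ᵐ t, t ∈ uIcc c d → HasDerivAt (cauchyData f) ![deriv f t, (V t - z) * f t] t := by
  have hf'' := (hf.1.2.2 c d hcd hs).boundedVariationOn.ae_differentiableAt_of_mem_uIcc
  filter_upwards [hf'', (ae_restrict_iff' hU.measurableSet).1 hf.2] with t hf''t htau hmem
  have htU : t ∈ U := hs (by rwa [uIcc_of_le hcd] at hmem)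
  have htau' := htau htU
  rw [tau] at htau'
  refine hasDerivAt_pi.2 (Fin.forall_fin_two.2 ⟨?_, ?_⟩)
  · exact (hf.1.2.1.differentiableAt (hU.mem_nhds htU)).hasDerivAt
  · exact (hf''t hmem).hasDerivAt.congr_deriv (by
      simp only [Matrix.cons_val_one, Matrix.cons_val_fin_one]
      linear_combination -htau')

theorem SolvesOn.wronskian_eq (hf : SolvesOn V z (Ioo l r) f) (hg : SolvesOn V z (Ioo l r) g)
    {s t : ℝ} (hs : s ∈ Ioo l r) (ht : t ∈ Ioo l r) :
    wronskian (cauchyData f s) (cauchyData g s) = wronskian (cauchyData f t) (cauchyData g t) := by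
  wlog hst : s ≤ t generalizing s t
  · exact (this ht hs (le_of_not_ge hst)).symm
  have hsub : Icc s t ⊆ Ioo l r := ordConnected_Ioo.out hs ht
  have hAC : AbsolutelyContinuousOnInterval
      (fun u => wronskian (cauchyData f u) (cauchyData g u)) s t :=
    ((hf.1.1 s t hst hsub).fun_smul (hg.1.2.2 s t hst hsub)).fun_sub
      ((hf.1.2.2 s t hst hsub).fun_smul (hg.1.1 s t hst hsub))
  obtain ⟨C, hC⟩ := hAC.const_of_ae_hasDerivAt_zero (by
    filter_upwards [hf.ae_hasDerivAt_cauchyData isOpen_Ioo hst hsub,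
      hg.ae_hasDerivAt_cauchyData isOpen_Ioo hst hsub] with u hfu hgu hu
    have hf' := hasDerivAt_pi.1 (hfu hu)
    have hg' := hasDerivAt_pi.1 (hgu hu)
    refine (((hf' 0).mul (hg' 1)).sub ((hf' 1).mul (hg' 0))).congr_deriv ?_
    simp only [cauchyData, Matrix.cons_val_zero, Matrix.cons_val_one, Matrix.cons_val_fin_one]
    ring)
  exact (hC s left_mem_uIcc).trans (hC t right_mem_uIcc).symm

theorem norm_vec_mul_le {F : Type*} [NormedRing F] (p q v : F) :
    ‖![q, v * p]‖ ≤ (1 + ‖v‖) * ‖![p, q]‖ := by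
  have hp : ‖p‖ ≤ ‖![p, q]‖ := norm_le_pi_norm ![p, q] 0
  have hq : ‖q‖ ≤ ‖![p, q]‖ := norm_le_pi_norm ![p, q] 1
  refine (pi_norm_le_iff_of_nonneg (by positivity)).2 (Fin.forall_fin_two.2 ⟨?_, ?_⟩)
  · calc ‖q‖ ≤ ‖![p, q]‖ := hq
      _ ≤ (1 + ‖v‖) * ‖![p, q]‖ := le_mul_of_one_le_left (norm_nonneg _) (by simp)
  · calc ‖v * p‖ ≤ ‖v‖ * ‖p‖ := norm_mul_le v p
      _ ≤ (1 + ‖v‖) * ‖![p, q]‖ := by gcongr; simp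

theorem SolvesOn.exists_norm_cauchyData_le (hf : SolvesOn V z (Ioo l r) f)
    (hV : IntegrableOn V (Ioo l r)) :
    ∃ C, ∀ s ∈ Ioo l r, ∀ t ∈ Ioo l r, ‖cauchyData f s‖ ≤ C * ‖cauchyData f t‖ := by
  set k : ℝ → ℝ := fun t => 1 + ‖(V t : ℂ) - z‖
  have hk0 (t : ℝ) : 0 ≤ k t := by positivity
  have hk : IntegrableOn k (Ioo l r) :=
    (integrable_const 1).add (hV.ofReal.sub (integrable_const z)).norm
  have hle {c d : ℝ} (hc : c ∈ Ioo l r) (hd : d ∈ Ioo l r) (hcd : c ≤ d) :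
      ‖cauchyData f d‖ ≤ Real.exp (∫ t in Ioo l r, k t) * ‖cauchyData f c‖ ∧
        ‖cauchyData f c‖ ≤ Real.exp (∫ t in Ioo l r, k t) * ‖cauchyData f d‖ := by
    have hsub : Icc c d ⊆ Ioo l r := ordConnected_Ioo.out hc hd
    have hki : IntervalIntegrable k volume c d :=
      (intervalIntegrable_iff_integrableOn_Icc_of_le hcd).2 (hk.mono_set hsub)
    have hint : ∫ t in c..d, k t ≤ ∫ t in Ioo l r, k t := by
      rw [intervalIntegral.integral_of_le hcd]
      exact setIntegral_mono_set hk (Eventually.of_forall hk0)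
        (Ioc_subset_Icc_self.trans hsub).eventuallyLE
    obtain ⟨hdc, hcd'⟩ := norm_le_exp_integral_mul_norm hcd
      (hf.1.absolutelyContinuousOnInterval_cauchyData hcd hsub)
      ((hf.ae_hasDerivAt_cauchyData isOpen_Ioo hcd hsub).mono
        fun t ht hmem => ⟨ht hmem, norm_vec_mul_le _ _ _⟩) hki
    exact ⟨hdc.trans (by gcongr), hcd'.trans (by gcongr)⟩
  refine ⟨Real.exp (∫ t in Ioo l r, k t), fun s hs t ht => ?_⟩
  rcases le_total s t with hst | hts
  · exact (hle hs ht hst).2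
  · exact (hle ht hs hts).1

end SolvesOn

section EndpointLimits

variable {V : ℝ → ℝ} {z : ℂ} {f g : ℝ → ℂ} {l r : ℝ} {F : Filter ℝ} [F.NeBot] {u v : Fin 2 → ℂ}

theorem SolvesOn.wronskian_eq_of_tendsto (hf : SolvesOn V z (Ioo l r) f)
    (hg : SolvesOn V z (Ioo l r) g) (hF : Ioo l r ∈ F) (hu : Tendsto (cauchyData f) F (𝓝 u))
    (hv : Tendsto (cauchyData g) F (𝓝 v)) {t : ℝ} (ht : t ∈ Ioo l r) :
    wronskian (cauchyData f t) (cauchyData g t) = wronskian u v :=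
  tendsto_nhds_unique_of_eventuallyEq tendsto_const_nhds (tendsto_wronskian hu hv)
    (by filter_upwards [hF] with s hs using hf.wronskian_eq hg ht hs)

theorem SolvesOn.cauchyData_eq_zero_iff_of_tendsto (hf : SolvesOn V z (Ioo l r) f)
    (hV : IntegrableOn V (Ioo l r)) (hF : Ioo l r ∈ F) (hu : Tendsto (cauchyData f) F (𝓝 u))
    {t : ℝ} (ht : t ∈ Ioo l r) : cauchyData f t = 0 ↔ u = 0 := by
  obtain ⟨C, hC⟩ := hf.exists_norm_cauchyData_le hV
  have hut : ‖u‖ ≤ C * ‖cauchyData f t‖ :=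
    le_of_tendsto hu.norm (by filter_upwards [hF] with s hs using hC s hs t ht)
  have htu : ‖cauchyData f t‖ ≤ C * ‖u‖ :=
    ge_of_tendsto (hu.norm.const_mul C) (by filter_upwards [hF] with s hs using hC t ht s hs)
  constructor <;> rintro h0
  · simpa only [h0, norm_zero, mul_zero, norm_le_zero_iff] using hut
  · simpa only [h0, norm_zero, mul_zero, norm_le_zero_iff] using htu

end EndpointLimits

/-! ### Solutions with interactions -/

theorem eq_of_isPreconnected_of_eventually_eq_nhdsWithin {X β : Type*} [TopologicalSpace X]
    {U T : Set X} (hU : IsPreconnected U) (hT : U ⊆ closure T) {W : X → β}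
    (hW : ∀ y ∈ U, ∃ k, ∀ᶠ t in 𝓝[T] y, W t = k) {s t : X} (hs : s ∈ U ∩ T) (ht : t ∈ U ∩ T) :
    W s = W t := by
  let P (y z : X) : Prop := ∃ k, (∀ᶠ t in 𝓝[T] y, W t = k) ∧ ∀ᶠ t in 𝓝[T] z, W t = k
  have hlocal : ∀ y ∈ U, ∀ᶠ z in 𝓝[U] y, P y z := by
    intro y hy
    obtain ⟨k, hk⟩ := hW y hy
    exact (eventually_nhds_nhdsWithin.2 hk).filter_mono nhdsWithin_le_nhds |>.mono
      fun z hz => ⟨k, hk, hz⟩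
  have htrans : ∀ w y z, w ∈ U → y ∈ U → z ∈ U → P w y → P y z → P w z := by
    rintro w y z - hy - ⟨k, hwk, hyk⟩ ⟨m, hym, hzm⟩
    have : (𝓝[T] y).NeBot := mem_closure_iff_nhdsWithin_neBot.1 (hT hy)
    obtain ⟨u, huk, hum⟩ := (hyk.and hym).exists
    exact ⟨k, hwk, huk.symm.trans hum ▸ hzm⟩
  obtain ⟨k, hsk, htk⟩ := hU.induction₂ P hlocal htrans
    (fun _ _ _ _ ⟨k, hy, hz⟩ => ⟨k, hz, hy⟩) hs.1 ht.1
  exact (hsk.self_of_nhdsWithin hs.2).trans (htk.self_of_nhdsWithin ht.2).symm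

section Piecewise

variable {ι : Type*} {x : ι → ℝ} {V : ℝ → ℝ} {U : Set ℝ}

/-- An open interval `U` in which the points `x n` do not accumulate and on which `V` is locally
integrable, so that every point of `U` has one-sided neighbourhoods on which the differential
equation is free of interactions and has an integrable potential. -/
structure IsRegularRegion (x : ι → ℝ) (V : ℝ → ℝ) (U : Set ℝ) : Prop where
  isOpen : IsOpen U
  isPreconnected : IsPreconnected U
  eventually_notMem : ∀ y ∈ U, ∀ᶠ t in 𝓝[≠] y, t ∉ range x
  locallyIntegrableOn : LocallyIntegrableOn V U

theorem IsRegularRegion.mono (hU : IsRegularRegion x V U) {W : Set ℝ} (hW : IsOpen W)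
    (hW' : IsPreconnected W) (h : W ⊆ U) : IsRegularRegion x V W :=
  ⟨hW, hW', fun y hy => hU.eventually_notMem y (h hy), hU.locallyIntegrableOn.mono_set h⟩

theorem IsRegularRegion.diff_range_mem_nhdsNE (hU : IsRegularRegion x V U) {y : ℝ} (hy : y ∈ U) :
    U \ range x ∈ 𝓝[≠] y :=
  inter_mem (mem_nhdsWithin_of_mem_nhds (hU.isOpen.mem_nhds hy)) (hU.eventually_notMem y hy)

theorem IsRegularRegion.exists_Ioo (hU : IsRegularRegion x V U) {y : ℝ} (hy : y ∈ U) :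
    ∃ l r, y ∈ Ioo l r ∧ Ioo l r ⊆ U ∧ IntegrableOn V (Ioo l r) ∧
      ∀ t ∈ Ioo l r, t ≠ y → t ∉ range x := by
  obtain ⟨s, hs, hVs⟩ := hU.locallyIntegrableOn y hy
  rw [hU.isOpen.nhdsWithin_eq hy] at hs
  obtain ⟨l, r, hlr, hsub⟩ := mem_nhds_iff_exists_Ioo_subset.1 (inter_mem
    (inter_mem hs (hU.isOpen.mem_nhds hy))
    (eventually_nhdsWithin_iff.1 (hU.eventually_notMem y hy)))
  exact ⟨l, r, hlr, fun t ht => (hsub ht).1.2, hVs.mono_set fun t ht => (hsub ht).1.1,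
    fun t ht => (hsub ht).2⟩

theorem IsRegularRegion.eq_of_forall_Ioo [Countable ι] (hU : IsRegularRegion x V U) {β : Type*}
    {W : ℝ → β}
    (hW : ∀ l r, Ioo l r ⊆ U \ range x → IntegrableOn V (Ioo l r) →
      ∀ s ∈ Ioo l r, ∀ t ∈ Ioo l r, W s = W t)
    (hWx : ∀ n l r, x n ∈ U → x n ∈ Ioo l r → Ioo l (x n) ⊆ U \ range x →
      Ioo (x n) r ⊆ U \ range x → IntegrableOn V (Ioo l r) →
      ∃ k, (∀ t ∈ Ioo l (x n), W t = k) ∧ ∀ t ∈ Ioo (x n) r, W t = k)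
    {s t : ℝ} (hs : s ∈ U \ range x) (ht : t ∈ U \ range x) : W s = W t := by
  have hdense : Dense (range x)ᶜ := (countable_range x).dense_compl ℝ
  refine eq_of_isPreconnected_of_eventually_eq_nhdsWithin hU.isPreconnected
    (hdense.closure_eq ▸ subset_univ U) (fun y hy => ?_) hs ht
  obtain ⟨l, r, hlr, hsub, hV, hx⟩ := hU.exists_Ioo hy
  by_cases hyx : y ∈ range x
  · obtain ⟨n, rfl⟩ := hyx
    obtain ⟨k, hkl, hkr⟩ := hWx n l r hy hlr
      (fun t ht => ⟨hsub ⟨ht.1, ht.2.trans hlr.2⟩, hx t ⟨ht.1, ht.2.trans hlr.2⟩ ht.2.ne⟩)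
      (fun t ht => ⟨hsub ⟨hlr.1.trans ht.1, ht.2⟩, hx t ⟨hlr.1.trans ht.1, ht.2⟩ ht.1.ne'⟩) hV
    refine ⟨k, eventually_nhdsWithin_iff.2 ?_⟩
    filter_upwards [Ioo_mem_nhds hlr.1 hlr.2] with t ht htx
    rcases lt_or_gt_of_ne (fun h => htx ⟨n, h.symm⟩ : t ≠ x n) with h | h
    · exact hkl t ⟨ht.1, h⟩
    · exact hkr t ⟨h, ht.2⟩
  · refine ⟨W y, eventually_nhdsWithin_iff.2 ?_⟩
    filter_upwards [Ioo_mem_nhds hlr.1 hlr.2] with t ht _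
    refine hW l r (fun u hu => ⟨hsub hu, ?_⟩) hV t ht y hlr
    rcases eq_or_ne u y with rfl | huy
    · exact hyx
    · exact hx u hu huy

/-- `f` solves `τ f = z f` on `U`, with interactions given by the matrices `A n` at `x n`. -/
structure PiecewiseSolvesOn (x : ι → ℝ) (V : ℝ → ℝ) (z : ℂ) (A : ι → Matrix (Fin 2) (Fin 2) ℝ)
    (U : Set ℝ) (f : ℝ → ℂ) : Prop where
  solvesOn : SolvesOn V z (U \ range x) f
  jump : ∀ n, x n ∈ U → JumpCondition (A n) (x n) f

variable {z : ℂ} {A : ι → Matrix (Fin 2) (Fin 2) ℝ} {f g h : ℝ → ℂ}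

theorem PiecewiseSolvesOn.mono (hf : PiecewiseSolvesOn x V z A U f) {W : Set ℝ} (h : W ⊆ U) :
    PiecewiseSolvesOn x V z A W f :=
  ⟨hf.solvesOn.mono (sdiff_subset_sdiff_left h), fun n hn => hf.jump n (h hn)⟩

theorem PiecewiseSolvesOn.congr {B : ι → Matrix (Fin 2) (Fin 2) ℝ}
    (hf : PiecewiseSolvesOn x V z A U f) (h : ∀ n, x n ∈ U → A n = B n) :
    PiecewiseSolvesOn x V z B U f :=
  ⟨hf.solvesOn, fun n hn => h n hn ▸ hf.jump n hn⟩

variable [Countable ι]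

theorem PiecewiseSolvesOn.wronskian_eq (hU : IsRegularRegion x V U) (hA : ∀ n, (A n).det = 1)
    (hf : PiecewiseSolvesOn x V z A U f) (hg : PiecewiseSolvesOn x V z A U g) {s t : ℝ}
    (hs : s ∈ U \ range x) (ht : t ∈ U \ range x) :
    wronskian (cauchyData f s) (cauchyData g s) = wronskian (cauchyData f t) (cauchyData g t) := by
  refine hU.eq_of_forall_Ioo (W := fun t => wronskian (cauchyData f t) (cauchyData g t)) ?_ ?_ hs ht
  · exact fun l r hsub _ s hs t ht =>
      (hf.solvesOn.mono hsub).wronskian_eq (hg.solvesOn.mono hsub) hs ht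
  · intro n l r hxU hn hL hR _
    obtain ⟨u, hu, hAu⟩ := jumpCondition_iff.1 (hf.jump n hxU)
    obtain ⟨v, hv, hAv⟩ := jumpCondition_iff.1 (hg.jump n hxU)
    refine ⟨wronskian u v, fun t ht => ?_, fun t ht => ?_⟩
    · exact (hf.solvesOn.mono hL).wronskian_eq_of_tendsto (hg.solvesOn.mono hL)
        (Ioo_mem_nhdsLT hn.1) hu hv ht
    · rw [(hf.solvesOn.mono hR).wronskian_eq_of_tendsto (hg.solvesOn.mono hR)
        (Ioo_mem_nhdsGT hn.2) hAu hAv ht, wronskian_map_ofReal_mulVec, hA, Complex.ofReal_one,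
        one_mul]

theorem PiecewiseSolvesOn.cauchyData_eq_zero_iff (hU : IsRegularRegion x V U)
    (hA : ∀ n, (A n).det ≠ 0) (hf : PiecewiseSolvesOn x V z A U f) {s t : ℝ}
    (hs : s ∈ U \ range x) (ht : t ∈ U \ range x) : cauchyData f s = 0 ↔ cauchyData f t = 0 := by
  refine iff_of_eq (hU.eq_of_forall_Ioo (W := fun t => cauchyData f t = 0) ?_ ?_ hs ht)
  · exact fun l r hsub hV s hs t ht => propext
      ((hf.solvesOn.mono hsub).cauchyData_eq_zero_iff_of_tendsto hV (mem_pure.2 ht)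
        (tendsto_pure_nhds _ _) hs)
  · intro n l r hxU hn hL hR hV
    obtain ⟨u, hu, hAu⟩ := jumpCondition_iff.1 (hf.jump n hxU)
    refine ⟨u = 0, fun t ht => propext ?_, fun t ht => propext ?_⟩
    · exact (hf.solvesOn.mono hL).cauchyData_eq_zero_iff_of_tendsto
        (hV.mono_set (Ioo_subset_Ioo_right hn.2.le)) (Ioo_mem_nhdsLT hn.1) hu ht
    · exact ((hf.solvesOn.mono hR).cauchyData_eq_zero_iff_of_tendsto
        (hV.mono_set (Ioo_subset_Ioo_left hn.1.le)) (Ioo_mem_nhdsGT hn.2) hAu ht).trans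
        (mulVec_map_ofReal_eq_zero_iff (hA n))

theorem IsRegularRegion.ae_mem_diff_range (hU : IsRegularRegion x V U) :
    ∀ᵐ t ∂volume.restrict U, t ∈ U \ range x :=
  (ae_restrict_mem hU.isOpen.measurableSet).and
    (ae_restrict_of_ae ((countable_range x).ae_notMem volume))

theorem PiecewiseSolvesOn.ae_eq_zero_of_tendsto_nhdsLT (hU : IsRegularRegion x V U)
    (hA : ∀ n, (A n).det ≠ 0) (hf : PiecewiseSolvesOn x V z A U f) {y : ℝ} (hy : y ∈ U)
    (h0 : Tendsto (cauchyData f) (𝓝[<] y) (𝓝 0)) : f =ᵐ[volume.restrict U] 0 := by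
  obtain ⟨l, r, hlr, hsub, hV, hx⟩ := hU.exists_Ioo hy
  have hL : Ioo l y ⊆ U \ range x := fun t ht =>
    ⟨hsub ⟨ht.1, ht.2.trans hlr.2⟩, hx t ⟨ht.1, ht.2.trans hlr.2⟩ ht.2.ne⟩
  obtain ⟨s, hs⟩ := nonempty_Ioo.2 hlr.1
  have hs0 : cauchyData f s = 0 := ((hf.solvesOn.mono hL).cauchyData_eq_zero_iff_of_tendsto
    (hV.mono_set (Ioo_subset_Ioo_right hlr.2.le)) (Ioo_mem_nhdsLT hlr.1) h0 hs).2 rfl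
  filter_upwards [hU.ae_mem_diff_range] with t ht
  exact congrFun ((hf.cauchyData_eq_zero_iff hU hA (hL hs) ht).1 hs0) 0

variable {F G : Filter ℝ} [F.NeBot] [G.NeBot] {u v : Fin 2 → ℂ}

theorem PiecewiseSolvesOn.wronskian_eq_of_tendsto (hU : IsRegularRegion x V U)
    (hA : ∀ n, (A n).det = 1) (hf : PiecewiseSolvesOn x V z A U f)
    (hg : PiecewiseSolvesOn x V z A U g) (hF : U \ range x ∈ F)
    (hu : Tendsto (cauchyData f) F (𝓝 u)) (hv : Tendsto (cauchyData g) F (𝓝 v)) {t : ℝ}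
    (ht : t ∈ U \ range x) :
    wronskian (cauchyData f t) (cauchyData g t) = wronskian u v :=
  tendsto_nhds_unique_of_eventuallyEq tendsto_const_nhds (tendsto_wronskian hu hv)
    (by filter_upwards [hF] with s hs using hf.wronskian_eq hU hA hg ht hs)

/-- Were the Wronskian of `f` and `g` nonzero, `h` would be a linear combination of `f` and `g`. -/
theorem PiecewiseSolvesOn.wronskian_eq_zero_of_not_memLp (hU : IsRegularRegion x V U)
    (hA : ∀ n, (A n).det = 1) (hf : PiecewiseSolvesOn x V z A U f)
    (hg : PiecewiseSolvesOn x V z A U g) (hh : PiecewiseSolvesOn x V z A U h) {p : ENNReal}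
    (hfp : MemLp f p (volume.restrict U)) (hgp : MemLp g p (volume.restrict U))
    (hhp : ¬ MemLp h p (volume.restrict U)) (hF : U \ range x ∈ F)
    (hu : Tendsto (cauchyData f) F (𝓝 u)) (hv : Tendsto (cauchyData g) F (𝓝 v)) :
    wronskian u v = 0 := by
  by_contra hne
  obtain ⟨s, hs⟩ := Filter.nonempty_of_mem hF
  let w (f g : ℝ → ℂ) : ℂ := wronskian (cauchyData f s) (cauchyData g s)
  refine hhp (((hfp.const_mul (w h g / wronskian u v)).add
    (hgp.const_mul (w f h / wronskian u v))).ae_eq ?_)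
  filter_upwards [hU.ae_mem_diff_range] with t ht
  have hcomb := congrFun
    (wronskian_smul_eq_add (cauchyData f t) (cauchyData g t) (cauchyData h t)) 0
  rw [hf.wronskian_eq_of_tendsto hU hA hg hF hu hv ht, hh.wronskian_eq hU hA hg ht hs,
    hf.wronskian_eq hU hA hh ht hs] at hcomb
  change wronskian u v * h t = w h g * f t + w f h * g t at hcomb
  simp only [Pi.add_apply]
  field_simp
  exact hcomb.symm

theorem PiecewiseSolvesOn.wronskian_eq_zero_of_boundaryCondition (hU : IsRegularRegion x V U)
    (hA : ∀ n, (A n).det = 1) (hf : PiecewiseSolvesOn x V z A U f)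
    (hg : PiecewiseSolvesOn x V z A U g) {ψ : ℝ} (hG : U \ range x ∈ G)
    (hfψ : BoundaryCondition ψ G f) (hgψ : BoundaryCondition ψ G g) (hF : U \ range x ∈ F)
    (hu : Tendsto (cauchyData f) F (𝓝 u)) (hv : Tendsto (cauchyData g) F (𝓝 v)) :
    wronskian u v = 0 := by
  obtain ⟨u', hu', hu0⟩ := boundaryCondition_iff.1 hfψ
  obtain ⟨v', hv', hv0⟩ := boundaryCondition_iff.1 hgψ
  have hψ : ![(Real.cos ψ : ℂ), (Real.sin ψ : ℂ)] ≠ 0 := by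
    intro h
    have hcos : Real.cos ψ = 0 := Complex.ofReal_eq_zero.1 (congrFun h 0)
    have hsin : Real.sin ψ = 0 := Complex.ofReal_eq_zero.1 (congrFun h 1)
    simpa [hcos, hsin] using Real.cos_sq_add_sin_sq ψ
  obtain ⟨t, ht⟩ := Filter.nonempty_of_mem hF
  calc wronskian u v = wronskian (cauchyData f t) (cauchyData g t) :=
        (hf.wronskian_eq_of_tendsto hU hA hg hF hu hv ht).symm
    _ = wronskian u' v' := hf.wronskian_eq_of_tendsto hU hA hg hG hu' hv' ht
    _ = 0 := wronskian_eq_zero_of_dotProduct_eq_zero hψ hu0 hv0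

end Piecewise

/-! ### Eigenfunctions on `(a, b)` -/

section Eigenfunction

theorem isOpen_openInterval (a b : EReal) : IsOpen (openInterval a b) :=
  isOpen_Ioo.preimage continuous_coe_real_ereal

theorem isPreconnected_openInterval (a b : EReal) : IsPreconnected (openInterval a b) :=
  (ordConnected_Ioo.preimage_mono EReal.coe_strictMono.monotone).isPreconnected

variable {a b : EReal} {V : ℝ → ℝ} {I : Set ℤ} {x : I → ℝ}

theorem isRegularRegion_openInterval (hV : LocallyIntegrableOn V (openInterval a b))
    (hx : ∀ c ∈ openInterval a b, ∀ d ∈ openInterval a b, (range x ∩ Icc c d).Finite) :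
    IsRegularRegion x V (openInterval a b) where
  isOpen := isOpen_openInterval a b
  isPreconnected := isPreconnected_openInterval a b
  locallyIntegrableOn := hV
  eventually_notMem y hy := by
    obtain ⟨c, d, hcd, hmem, hsub⟩ :=
      exists_Icc_mem_subset_of_mem_nhds ((isOpen_openInterval a b).mem_nhds hy)
    have hle : c ≤ d := hcd.1.trans hcd.2
    have hfin : ((range x ∩ Icc c d) \ {y}).Finite :=
      (hx c (hsub (left_mem_Icc.2 hle)) d (hsub (right_mem_Icc.2 hle))).sdiff
    have hcompl : ((range x ∩ Icc c d) \ {y})ᶜ ∈ 𝓝 y :=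
      hfin.isClosed.isOpen_compl.mem_nhds fun h => h.2 rfl
    rw [eventually_nhdsWithin_iff]
    filter_upwards [hcompl, hmem] with t ht htm hty htx using ht ⟨⟨htx, htm⟩, hty⟩

theorem RegularLeft.diff_range_mem_nhdsGT {a₀ y : ℝ} (h : RegularLeft a b V x a₀)
    (hy : a < y) : openInterval a y \ range x ∈ 𝓝[>] a₀ := by
  obtain ⟨rfl, -, c, hc, hcx⟩ := h
  filter_upwards [Ioo_mem_nhdsGT hc, Ioo_mem_nhdsGT (EReal.coe_lt_coe_iff.1 hy)] with t htc hty
  refine ⟨⟨EReal.coe_lt_coe_iff.2 htc.1, EReal.coe_lt_coe_iff.2 hty.2⟩, ?_⟩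
  rintro ⟨n, rfl⟩
  exact (hcx n).not_gt htc.2

theorem RegularRight.diff_range_mem_nhdsLT {b₀ y : ℝ} (h : RegularRight a b V x b₀)
    (hy : y < b) : openInterval y b \ range x ∈ 𝓝[<] b₀ := by
  obtain ⟨rfl, -, c, hc, hcx⟩ := h
  filter_upwards [Ioo_mem_nhdsLT hc, Ioo_mem_nhdsLT (EReal.coe_lt_coe_iff.1 hy)] with t htc hty
  refine ⟨⟨EReal.coe_lt_coe_iff.2 hty.1, EReal.coe_lt_coe_iff.2 htc.2⟩, ?_⟩
  rintro ⟨n, rfl⟩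
  exact (hcx n).not_gt htc.1

variable {Λ Λ' : I → ℝ} {R R' : I → Ioi (0 : ℝ)} {Θ Θ' : I → ℝ} {ψa ψb E : ℝ} {f g : ℝ → ℂ}

theorem IsSolution.piecewiseSolvesOn {z : ℂ} (hf : IsSolution a b V x Λ R Θ z f) :
    PiecewiseSolvesOn x V z (fun n => interactionMatrix (Λ n) (R n) (Θ n))
      (openInterval a b) f := by
  refine ⟨⟨hf.1, ?_⟩, fun n _ => hf.2.2 n⟩
  filter_upwards [ae_restrict_of_ae_restrict_of_subset sdiff_subset hf.2.1] with t ht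
  exact sub_eq_zero.1 ht

/-- `f` is an eigenfunction of `H_{Λ,R,Θ}` with eigenvalue `E`. -/
def IsEigenfunction (a b : EReal) (V : ℝ → ℝ) (x : I → ℝ) (Λ : I → ℝ) (R : I → Ioi (0 : ℝ))
    (Θ : I → ℝ) (ψa ψb E : ℝ) (f : ℝ → ℂ) : Prop :=
  MemDomain a b V x Λ R Θ ψa ψb f ∧ ¬ f =ᵐ[volume.restrict (openInterval a b)] 0 ∧
    tau V f =ᵐ[volume.restrict (openInterval a b)] fun t => (E : ℂ) * f t

theorem IsEigenfunction.piecewiseSolvesOn (hf : IsEigenfunction a b V x Λ R Θ ψa ψb E f) :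
    PiecewiseSolvesOn x V E (fun n => interactionMatrix (Λ n) (R n) (Θ n))
      (openInterval a b) f :=
  ⟨⟨hf.1.1.2.1, ae_restrict_of_ae_restrict_of_subset sdiff_subset hf.2.2⟩,
    fun n _ => hf.1.1.2.2.2 n⟩

theorem IsEigenfunction.memLp_of_subset (hf : IsEigenfunction a b V x Λ R Θ ψa ψb E f)
    {U : Set ℝ} (hU : U ⊆ openInterval a b) : MemLp f 2 (volume.restrict U) :=
  hf.1.1.1.mono_measure (Measure.restrict_mono_set volume hU)

theorem MemDomain.star (hf : MemDomain a b V x Λ R Θ ψa ψb f) :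
    MemDomain a b V x Λ R Θ ψa ψb (star f) := by
  obtain ⟨⟨hfL, hfAC, hfτ, hfx⟩, hfa, hfb⟩ := hf
  have hτ : tau V (Star.star f) = Star.star (tau V f) := funext (tau_star V f)
  exact ⟨⟨hfL.star, hfAC.star, hτ ▸ hfτ.star, fun n => (hfx n).star⟩,
    fun a₀ h => (hfa a₀ h).star, fun b₀ h => (hfb b₀ h).star⟩

theorem IsEigenfunction.star (hf : IsEigenfunction a b V x Λ R Θ ψa ψb E f) :
    IsEigenfunction a b V x Λ R Θ ψa ψb E (star f) := by
  refine ⟨hf.1.star, fun h => hf.2.1 ?_, ?_⟩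
  · filter_upwards [h] with t ht using star_eq_zero.1 ht
  · filter_upwards [hf.2.2] with t ht
    rw [tau_star, ht, star_mul', Complex.star_def, Complex.conj_ofReal]
    rfl

theorem IsEigenfunction.ne_zero_of_tendsto_nhdsLT (hU : IsRegularRegion x V (openInterval a b))
    (hf : IsEigenfunction a b V x Λ R Θ ψa ψb E f) {y : ℝ} (hy : y ∈ openInterval a b)
    {u : Fin 2 → ℂ} (hu : Tendsto (cauchyData f) (𝓝[<] y) (𝓝 u)) : u ≠ 0 := by
  rintro rfl
  refine hf.2.1 (hf.piecewiseSolvesOn.ae_eq_zero_of_tendsto_nhdsLT hU (fun n => ?_) hy hu)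
  rw [det_interactionMatrix _ _ (R n).2.ne']
  exact one_ne_zero

theorem IsEigenfunction.wronskian_eq_zero_of_tendsto_nhdsLT
    (hU : IsRegularRegion x V (openInterval a b))
    (ha : LimitPointLeft a b V x Λ R Θ ∨ ∃ a₀ : ℝ, RegularLeft a b V x a₀)
    (hf : IsEigenfunction a b V x Λ R Θ ψa ψb E f)
    (hg : IsEigenfunction a b V x Λ' R' Θ' ψa ψb E g) {y : ℝ} (hy : y ∈ openInterval a b)
    (hA : ∀ n, x n < y → interactionMatrix (Λ' n) (R' n) (Θ' n) =
      interactionMatrix (Λ n) (R n) (Θ n)) {u v : Fin 2 → ℂ}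
    (hu : Tendsto (cauchyData f) (𝓝[<] y) (𝓝 u)) (hv : Tendsto (cauchyData g) (𝓝[<] y) (𝓝 v)) :
    wronskian u v = 0 := by
  have hsub : openInterval a y ⊆ openInterval a b := fun t ht => ⟨ht.1, ht.2.trans hy.2⟩
  have hUa : IsRegularRegion x V (openInterval a y) :=
    hU.mono (isOpen_openInterval _ _) (isPreconnected_openInterval _ _) hsub
  have hdet (n : I) : (interactionMatrix (Λ n) (R n) (Θ n)).det = 1 :=
    det_interactionMatrix _ _ (R n).2.ne'
  have hfa := hf.piecewiseSolvesOn.mono hsub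
  have hga := (hg.piecewiseSolvesOn.mono hsub).congr
    fun n hn => hA n (EReal.coe_lt_coe_iff.1 hn.2)
  have hF : openInterval a y \ range x ∈ 𝓝[<] y := by
    filter_upwards [self_mem_nhdsWithin, nhdsLT_le_nhdsNE y (hU.diff_range_mem_nhdsNE hy)]
      with t hty ht using ⟨⟨ht.1.1, EReal.coe_lt_coe_iff.2 hty⟩, ht.2⟩
  rcases ha with hlp | ⟨a₀, hreg⟩
  · obtain ⟨h, hh, hhL⟩ := hlp E
    exact hfa.wronskian_eq_zero_of_not_memLp hUa hdet hga (hh.piecewiseSolvesOn.mono hsub)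
      (hf.memLp_of_subset hsub) (hg.memLp_of_subset hsub) (fun hhy => hhL ⟨y, hy, hhy⟩) hF hu hv
  · exact hfa.wronskian_eq_zero_of_boundaryCondition hUa hdet hga
      (hreg.diff_range_mem_nhdsGT hy.1) (hf.1.2.1 a₀ hreg) (hg.1.2.1 a₀ hreg) hF hu hv

theorem IsEigenfunction.wronskian_eq_zero_of_tendsto_nhdsGT
    (hU : IsRegularRegion x V (openInterval a b))
    (hb : LimitPointRight a b V x Λ R Θ ∨ ∃ b₀ : ℝ, RegularRight a b V x b₀)
    (hf : IsEigenfunction a b V x Λ R Θ ψa ψb E f)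
    (hg : IsEigenfunction a b V x Λ' R' Θ' ψa ψb E g) {y : ℝ} (hy : y ∈ openInterval a b)
    (hA : ∀ n, y < x n → interactionMatrix (Λ' n) (R' n) (Θ' n) =
      interactionMatrix (Λ n) (R n) (Θ n)) {u v : Fin 2 → ℂ}
    (hu : Tendsto (cauchyData f) (𝓝[>] y) (𝓝 u)) (hv : Tendsto (cauchyData g) (𝓝[>] y) (𝓝 v)) :
    wronskian u v = 0 := by
  have hsub : openInterval y b ⊆ openInterval a b := fun t ht => ⟨hy.1.trans ht.1, ht.2⟩
  have hUb : IsRegularRegion x V (openInterval y b) :=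
    hU.mono (isOpen_openInterval _ _) (isPreconnected_openInterval _ _) hsub
  have hdet (n : I) : (interactionMatrix (Λ n) (R n) (Θ n)).det = 1 :=
    det_interactionMatrix _ _ (R n).2.ne'
  have hfb := hf.piecewiseSolvesOn.mono hsub
  have hgb := (hg.piecewiseSolvesOn.mono hsub).congr
    fun n hn => hA n (EReal.coe_lt_coe_iff.1 hn.1)
  have hF : openInterval y b \ range x ∈ 𝓝[>] y := by
    filter_upwards [self_mem_nhdsWithin, nhdsGT_le_nhdsNE y (hU.diff_range_mem_nhdsNE hy)]
      with t hty ht using ⟨⟨EReal.coe_lt_coe_iff.2 hty, ht.1.2⟩, ht.2⟩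
  rcases hb with hlp | ⟨b₀, hreg⟩
  · obtain ⟨h, hh, hhL⟩ := hlp E
    exact hfb.wronskian_eq_zero_of_not_memLp hUb hdet hgb (hh.piecewiseSolvesOn.mono hsub)
      (hf.memLp_of_subset hsub) (hg.memLp_of_subset hsub) (fun hhy => hhL ⟨y, hy, hhy⟩) hF hu hv
  · exact hfb.wronskian_eq_zero_of_boundaryCondition hUb hdet hgb
      (hreg.diff_range_mem_nhdsLT hy.2) (hf.1.2.2 b₀ hreg) (hg.1.2.2 b₀ hreg) hF hu hv

theorem IsEigenfunction.sin_sub_eq_zero (hU : IsRegularRegion x V (openInterval a b)) {n₀ : I}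
    (hn₀ : x n₀ ∈ openInterval a b) (hΘ : ∀ n ≠ n₀, Θ' n = Θ n)
    (ha : LimitPointLeft a b V x Λ R Θ ∨ ∃ a₀ : ℝ, RegularLeft a b V x a₀)
    (hb : LimitPointRight a b V x Λ R Θ ∨ ∃ b₀ : ℝ, RegularRight a b V x b₀)
    (hf : IsEigenfunction a b V x Λ R Θ ψa ψb E f)
    (hg : IsEigenfunction a b V x Λ R Θ' ψa ψb E g) : Real.sin (Θ' n₀ - Θ n₀) = 0 := by
  have hA (n : I) (hn : x n ≠ x n₀) : interactionMatrix (Λ n) (R n) (Θ' n) =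
      interactionMatrix (Λ n) (R n) (Θ n) := by rw [hΘ n (ne_of_apply_ne x hn)]
  obtain ⟨u, hu, hAu⟩ := jumpCondition_iff.1 (hf.1.1.2.2.2 n₀)
  obtain ⟨v, hv, -⟩ := jumpCondition_iff.1 (hg.1.1.2.2.2 n₀)
  obtain ⟨w, hw, hAw⟩ := jumpCondition_iff.1 (hg.star.1.1.2.2.2 n₀)
  obtain rfl : w = Star.star v := tendsto_nhds_unique hw (tendsto_cauchyData_star hv)
  exact sin_sub_eq_zero_of_wronskian_eq_zero (R n₀).2.ne'
    (hf.ne_zero_of_tendsto_nhdsLT hU hn₀ hu) (hg.ne_zero_of_tendsto_nhdsLT hU hn₀ hv)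
    (hf.wronskian_eq_zero_of_tendsto_nhdsLT hU ha hg hn₀ (fun n hn => hA n hn.ne) hu hv)
    (hf.wronskian_eq_zero_of_tendsto_nhdsLT hU ha hg.star hn₀ (fun n hn => hA n hn.ne) hu hw)
    (hf.wronskian_eq_zero_of_tendsto_nhdsGT hU hb hg.star hn₀ (fun n hn => hA n hn.ne') hAu hAw)

theorem countable_setOf_isEigenvalue_update (hU : IsRegularRegion x V (openInterval a b)) {n₀ : I}
    (hn₀ : x n₀ ∈ openInterval a b)
    (ha : ∀ Θ, LimitPointLeft a b V x Λ R Θ ∨ ∃ a₀ : ℝ, RegularLeft a b V x a₀)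
    (hb : ∀ Θ, LimitPointRight a b V x Λ R Θ ∨ ∃ b₀ : ℝ, RegularRight a b V x b₀) :
    {θ | IsEigenvalue a b V x Λ R (Function.update Θ n₀ θ) ψa ψb E}.Countable := by
  refine countable_of_forall_sin_sub_eq_zero ?_
  rintro θ ⟨f, hf⟩ θ' ⟨g, hg⟩
  have hsin : Real.sin (Function.update Θ n₀ θ' n₀ - Function.update Θ n₀ θ n₀) = 0 :=
    IsEigenfunction.sin_sub_eq_zero hU hn₀
      (fun n hn => by rw [Function.update_of_ne hn, Function.update_of_ne hn])
      (ha _) (hb _) hf hg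
  rwa [Function.update_self, Function.update_self] at hsin

end Eigenfunction

/-! ### Resampling one coordinate of a product measure -/

section Resampling

variable {ι : Type*} [DecidableEq ι] {X : ι → Type*} [∀ i, MeasurableSpace (X i)]
  (μ : ∀ i, Measure (X i)) [∀ i, IsProbabilityMeasure (μ i)]

theorem map_update_infinitePi_prod (j : ι) :
    ((Measure.infinitePi μ).prod (μ j)).map (fun z => Function.update z.1 j z.2) =
      Measure.infinitePi μ := by
  refine Measure.eq_infinitePi _ fun s t ht => ?_
  rw [Measure.map_apply measurable_update' (MeasurableSet.pi s.countable_toSet fun i _ => ht i)]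
  have hpre : (fun z : (∀ i, X i) × X j => Function.update z.1 j z.2) ⁻¹' (Set.pi s t) =
      Set.pi (s.erase j : Finset ι) t ×ˢ {y | j ∈ s → y ∈ t j} := by
    ext z
    refine (Function.forall_update_iff z.1 fun i y => i ∈ s → y ∈ t i).trans ?_
    simp only [mem_prod, Set.mem_pi, Finset.mem_coe, Finset.mem_erase, and_imp]
    exact and_comm
  rw [hpre, Measure.prod_prod, Measure.infinitePi_pi _ fun i _ => ht i]
  by_cases hj : j ∈ s
  · simp only [hj, forall_const, ofPred_mem_eq, Finset.prod_erase_mul]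
  · simp only [hj, IsEmpty.forall_iff, ofPred_true, measure_univ, mul_one,
      Finset.erase_eq_of_notMem, not_false_eq_true]

theorem infinitePi_eq_zero_of_forall_update (j : ι) {S : Set (∀ i, X i)} (hS : MeasurableSet S)
    (h : ∀ z, μ j {y | Function.update z j y ∈ S} = 0) : Measure.infinitePi μ S = 0 := by
  rw [← map_update_infinitePi_prod μ j, Measure.map_apply measurable_update' hS,
    Measure.measure_prod_null (measurable_update' hS)]
  exact Eventually.of_forall h

end Resampling

theorem parameterLaw_eq_zero_of_forall_update {I : Set ℤ} (p : I → Measure ℝ)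
    [∀ n, IsProbabilityMeasure (p n)] (ρ : I → Measure (Ioi (0 : ℝ)))
    [∀ n, IsProbabilityMeasure (ρ n)] (q : I → Measure ℝ) [∀ n, IsProbabilityMeasure (q n)]
    (n₀ : I) {S : Set ((I → ℝ) × (I → Ioi (0 : ℝ)) × (I → ℝ))}
    (hS : NullMeasurableSet S (parameterLaw p ρ q))
    (h : ∀ Λ R Θ, q n₀ {θ | (Λ, R, Function.update Θ n₀ θ) ∈ S} = 0) :
    parameterLaw p ρ q S = 0 := by
  obtain ⟨T, hTS, hT, hT_ae⟩ := hS.exists_measurable_subset_ae_eq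
  rw [← measure_congr hT_ae, parameterLaw, Measure.measure_prod_null hT]
  refine Eventually.of_forall fun Λ => ?_
  change _ = 0
  rw [Measure.measure_prod_null (measurable_prodMk_left hT)]
  refine Eventually.of_forall fun R => ?_
  exact infinitePi_eq_zero_of_forall_update q n₀
    (measurable_prodMk_left (measurable_prodMk_left hT))
    fun Θ => measure_mono_null (fun θ hθ => hTS hθ) (h Λ R Θ)

end PointInteraction

theorem mainTheorem5
    (a b : EReal) (hab : a < b)
    (V : ℝ → ℝ) (hV : LocallyIntegrableOn V (PointInteraction.openInterval a b))
    (I : Set ℤ) (x : I → ℝ) (hx_inj : Function.Injective x)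
    (hx_mem : ∀ n, x n ∈ PointInteraction.openInterval a b)
    (hx_acc : ∀ c ∈ PointInteraction.openInterval a b, ∀ d ∈ PointInteraction.openInterval a b,
      (range x ∩ Icc c d).Finite)
    (ψa ψb : ℝ) (hψa : ψa ∈ Ico 0 Real.pi) (hψb : ψb ∈ Ico 0 Real.pi)
    (ha : ∀ (Λ : I → ℝ) (R : I → Ioi (0 : ℝ)) (Θ : I → ℝ),
      PointInteraction.LimitPointLeft a b V x Λ R Θ ∨
        ∃ a₀ : ℝ, PointInteraction.RegularLeft a b V x a₀)
    (hb : ∀ (Λ : I → ℝ) (R : I → Ioi (0 : ℝ)) (Θ : I → ℝ),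
      PointInteraction.LimitPointRight a b V x Λ R Θ ∨
        ∃ b₀ : ℝ, PointInteraction.RegularRight a b V x b₀)
    (p : I → Measure ℝ) [∀ n, IsProbabilityMeasure (p n)]
    (ρ : I → Measure (Ioi (0 : ℝ))) [∀ n, IsProbabilityMeasure (ρ n)]
    (q : I → Measure ℝ) [∀ n, IsProbabilityMeasure (q n)]
    (n₀ : I) (hq : ∀ t : ℝ, q n₀ {t} = 0)
    (E : ℝ)
    (hE : NullMeasurableSet (PointInteraction.eigenvalueSet a b V x ψa ψb E)
      (PointInteraction.parameterLaw p ρ q)) :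
    PointInteraction.parameterLaw p ρ q
      (PointInteraction.eigenvalueSet a b V x ψa ψb E) = 0 := by
  have hU := PointInteraction.isRegularRegion_openInterval hV hx_acc
  have : NullSingletonClass (q n₀) := ⟨hq⟩
  exact PointInteraction.parameterLaw_eq_zero_of_forall_update p ρ q n₀ hE fun Λ R Θ =>
    (PointInteraction.countable_setOf_isEigenvalue_update hU (hx_mem n₀) (ha Λ R) (hb Λ R)
      ).measure_zero (q n₀)
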